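/- Let $\mathcal A$ be a non-empty finite or countable alphabet, $X=\mathcal A^{\mathbb N}$ with its product (Borel) $\sigma$-field, and $T:X\to X$ the shift $(x_1,x_2,\dots)\mapsto(x_2,x_3,\dots)$. Let $g_n:\mathcal A\to(0,\infty)$, $n\ge 1$, and $g(x)=\prod_{n\ge 1} g_n(x_n)$. Assume that $g$ is $\ell_1$-bounded, i.e. $\sum_{k\ge 2}\|\log g_k\|_\infty<\infty$, and summable, i.e. $\sum_{a\in\mathcal A} g_1(a)<\infty$. Write $$\mathcal L_{\log g}\phi(x)=\sum_{T y=x} g(y)\phi(y),\qquad \lambda=\sum_{a\in\mathcal A}\prod_{k=1}^\infty g_k(a).$$ Let $\mu=\bigotimes_{n\ge1}\mu_n$ be the product measure and $\tilde\mu=\bigotimes_{n\ge 1}\tilde\mu_0$ the Bernoulli measure on $X$ with $$\mu_n(a)=\frac{\prod_{i=1}^n g_i(a)}{\sum_{b}\prod_{i=1}^n g_i(b)},\qquad \tilde\mu_0(a)=\frac{\prod_{i=1}^\infty g_i(a)}{\sum_{b}\prod_{i=1}^\infty g_i(b)},$$ and let $$h_\mu(x)=\lim_{n\to\infty}\prod_{j=1}^{n}\left(\frac{\sum_{a}\prod_{l=1}^j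 g_l(a)}{\sum_{a}\prod_{l=1}^\infty g_l(a)}\prod_{l=1}^\infty g_{l+j}(x_j)\right)$$ wherever this limit exists in $\mathbb R$. Then: \begin{enumerate} \item Up to equality $\mu$-a.e., there is at most one $h\in L^1(X,\mu)$ with $\mathcal L_{\log g}(h)=\lambda h$ $\mu$-a.e. and $\int h\,d\mu=1$. \item If $g$ has $\ell_2$-bounded tails, i.e. $\sum_{i=k}^\infty\sup_{a\in\mathcal A}\bigl(\sum_{j=i}^\infty\log g_j(a)\bigr)^2<\infty$ for some $k\in\mathbb N$, then $h_\mu\in L^1(X,\mu)$, $\int h_\mu\,d\mu=1$, $\mathcal L_{\log g}(h_\mu)=\lambda h_\mu$ $\mu$-a.e. (the sum converging absolutely $\mu$-a.e.), and $d\tilde\mu=h_\mu\,d\mu$. \item In general, the limit defining $h_\mu$ exists and is finite $\mu$-a.s., and $h_\mu\in L^1(X,\mu)$. Moreover, $\int h_\mu\,d\mu>0$ if and only if $\mu$ and $\tilde\mu$ are equivalent (mutually absolutely continuous); if $\int h_\mu\,d\mu=0$, then $\mu$ and $\tilde\mu$ are mutually singular. \end{enumerate} -/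

import Mathlib

open MeasureTheory Filter Topology
open scoped ENNReal

noncomputable section

namespace ProductPotential

variable {A : Type*}

/-- The one-sided full shift `X = A^ℕ`. Coordinates are indexed from `0`: `x n` is the
`(n+1)`-st letter of `x`. -/
abbrev Seq (A : Type*) : Type _ := ℕ → A

/-- The shift map, which deletes the first letter. -/
def shift (x : Seq A) : Seq A := fun n => x (n + 1)

/-- The Ruelle operator `(L_f φ)(x) = ∑_{T y = x} φ(y) exp(f(y))`. -/
def ruelle (f φ : Seq A → ℝ) (x : Seq A) : ℝ :=
  ∑' y : {y : Seq A // shift y = x}, φ y * Real.exp (f y)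

/-- The sum that defines the Ruelle operator at `x` converges absolutely. -/
def RuelleConverges (f φ : Seq A → ℝ) (x : Seq A) : Prop :=
  Summable fun y : {y : Seq A // shift y = x} => φ y * Real.exp (f y)

/-- The potential of product type with factors `g`. Factors are indexed from `0`: `g n` is the
`(n+1)`-st factor, a function of the `(n+1)`-st letter. -/
def potential (g : ℕ → A → ℝ) (x : Seq A) : ℝ := ∏' n, g n (x n)

/-- `ℓ₁`-boundedness: the sup norms of the logarithms of all factors except the first one are
summable. The sum and the sup norms are taken in `[0, ∞]`. -/
def L1Bounded (g : ℕ → A → ℝ) : Prop :=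
  ∑' k, ⨆ a, ‖Real.log (g (k + 1) a)‖ₑ < ∞

/-- Summability of the first factor over the alphabet. -/
def SummablePotential (g : ℕ → A → ℝ) : Prop := Summable (g 0)

/-- `ℓ₂`-bounded tails: from some index on, the squares of the tails of `∑ log g_j` are summable
uniformly in the letter. The outer sum and the supremum are taken in `[0, ∞]`. -/
def L2BoundedTails (g : ℕ → A → ℝ) : Prop :=
  ∃ k : ℕ, ∑' i, ⨆ a, ‖∑' j, Real.log (g (k + i + j) a)‖ₑ ^ 2 < ∞

/-- The product of the first `n + 1` factors, all evaluated at the same letter `a`. -/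
def partialWeight (g : ℕ → A → ℝ) (n : ℕ) (a : A) : ℝ := ∏ i ∈ Finset.range (n + 1), g i a

/-- The product of all factors, all evaluated at the same letter `a`. -/
def fullWeight (g : ℕ → A → ℝ) (a : A) : ℝ := ∏' i, g i a

/-- The eigenvalue `λ = ∑_a ∏_k g_k(a)`. -/
def eigenvalue (g : ℕ → A → ℝ) : ℝ := ∑' a, fullWeight g a

/-- The measure on the alphabet with mass `w a / ∑_b w b` at `a`. -/
def normalizedMeasure [MeasurableSpace A] (w : A → ℝ) : Measure A :=
  Measure.sum fun a => ENNReal.ofReal (w a / ∑' b, w b) • Measure.dirac a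

/-- The product measure `μ = ⊗ μ_n`, where `μ_n` has weights proportional to
`∏_{i ≤ n} g_i(a)`. -/
def conformalMeasure [MeasurableSpace A] (g : ℕ → A → ℝ) : Measure (Seq A) :=
  Measure.infinitePi fun n => normalizedMeasure (partialWeight g n)

/-- The stationary Bernoulli measure with weights proportional to `∏_i g_i(a)`. -/
def equilibriumMeasure [MeasurableSpace A] (g : ℕ → A → ℝ) : Measure (Seq A) :=
  Measure.infinitePi fun _ : ℕ => normalizedMeasure (fullWeight g)

/-- The `j`-th factor of `h_μ` as a function of the `j`-th letter. -/
def hFactor (g : ℕ → A → ℝ) (j : ℕ) (a : A) : ℝ :=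
  (∑' b, partialWeight g j b) / (∑' b, fullWeight g b) * ∏' l, g (l + 1 + j) a

/-- The product of the first `n` factors of `h_μ`. -/
def hPartial (g : ℕ → A → ℝ) (n : ℕ) (x : Seq A) : ℝ :=
  ∏ j ∈ Finset.range n, hFactor g j (x j)

/-- The function `h_μ`: the limit of the partial products in their natural order (in general the
infinite product converges only conditionally), wherever this limit exists in `ℝ`. -/
def hMu (g : ℕ → A → ℝ) (x : Seq A) : ℝ := limUnder atTop fun n => hPartial g n x

end ProductPotential

end

/-!
`conformalMeasure g` and `equilibriumMeasure g` are product measures with equivalent factors, and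
`hPartial g n` is the Radon–Nikodym derivative of the second with respect to the first on the
first `n` coordinates. By martingale convergence it converges almost everywhere to the density of
the absolutely continuous part, so `hMu g` is that density. Kolmogorov's zero-one law makes the two
measures either equivalent or mutually singular (Kakutani's dichotomy), and square-summable
logarithms of the factors exclude singularity.

Write `μ` for `conformalMeasure g`, `T` for the shift, `𝓛` for the Ruelle operator and `λ` for
`eigenvalue g`. Conformality, `∫ 𝓛 f dμ = λ ∫ f dμ`, localises to
`∫_B 𝓛 f dμ = λ ∫_{T⁻¹ B} f dμ`, so `𝓛 h = λ h` says precisely that the signed measure `h dμ` is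
shift-invariant; the density of the Bernoulli measure is therefore an eigenfunction. For
uniqueness, let `h dμ` be shift-invariant with `∫ h dμ = 0`, and let `hₙ` be the conditional
expectation of `h` on the first `n` coordinates. These are independent of `T⁻ⁿ B`, so
`∫_{T⁻ⁿ B} hₙ dμ = 0`, and `|∫_B h dμ| = |∫_{T⁻ⁿ B} (h - hₙ) dμ| ≤ ‖h - hₙ‖₁ → 0`.
-/

namespace ProductPotential

open ProbabilityTheory

section TrimmedDensity

variable {Ω : Type*} {m0 : MeasurableSpace Ω}

theorem tendsto_toReal_rnDeriv_trim_of_absolutelyContinuous {μ ν : Measure Ω}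
    [IsFiniteMeasure μ] [IsFiniteMeasure ν] (hμν : μ ≪ ν) (ℱ : Filtration ℕ m0)
    (hℱ : ⨆ n, ℱ n = m0) :
    ∀ᵐ x ∂ν, Tendsto (fun n => ((μ.trim (ℱ.le n)).rnDeriv (ν.trim (ℱ.le n)) x).toReal) atTop
      (𝓝 (μ.rnDeriv ν x).toReal) := by
  have htrim : ∀ᵐ x ∂ν, ∀ n, ((μ.trim (ℱ.le n)).rnDeriv (ν.trim (ℱ.le n)) x).toReal =
      (ν[fun y => (μ.rnDeriv ν y).toReal | ℱ n]) x :=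
    ae_all_iff.2 fun n => ae_eq_of_ae_eq_trim (toReal_rnDeriv_trim (ℱ.le n) hμν)
  have hmeas : StronglyMeasurable[⨆ n, ℱ n] fun y => (μ.rnDeriv ν y).toReal := by
    rw [hℱ]
    exact (Measure.measurable_rnDeriv μ ν).ennreal_toReal.stronglyMeasurable
  filter_upwards [htrim, Measure.integrable_toReal_rnDeriv.tendsto_ae_condExp hmeas] with x hx hlim
  exact hlim.congr fun n => (hx n).symm

theorem tendsto_toReal_rnDeriv_trim (μ ν : Measure Ω) [IsFiniteMeasure μ] [IsFiniteMeasure ν]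
    (ℱ : Filtration ℕ m0) (hℱ : ⨆ n, ℱ n = m0) :
    ∀ᵐ x ∂ν, Tendsto (fun n => ((μ.trim (ℱ.le n)).rnDeriv (ν.trim (ℱ.le n)) x).toReal) atTop
      (𝓝 (μ.rnDeriv ν x).toReal) := by
  -- reduces to the absolutely continuous case: divide the densities with respect to `μ + ν`
  have hν : ν ≪ μ + ν := (Measure.le_add_left le_rfl).absolutelyContinuous
  have hμlim := hν (tendsto_toReal_rnDeriv_trim_of_absolutelyContinuous
    (Measure.le_add_right le_rfl : μ ≤ μ + ν).absolutelyContinuous ℱ hℱ)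
  have hνlim := hν (tendsto_toReal_rnDeriv_trim_of_absolutelyContinuous hν ℱ hℱ)
  have htrim : ∀ᵐ x ∂ν, ∀ n, (μ.trim (ℱ.le n)).rnDeriv (ν.trim (ℱ.le n)) x =
      (μ.trim (ℱ.le n)).rnDeriv ((μ + ν).trim (ℱ.le n)) x /
        (ν.trim (ℱ.le n)).rnDeriv ((μ + ν).trim (ℱ.le n)) x := by
    refine ae_all_iff.2 fun n => ae_eq_of_ae_eq_trim (hm := ℱ.le n) ?_
    simpa only [trim_add] using Measure.rnDeriv_eq_div_rnDeriv_add
      (μ.trim (ℱ.le n)) (ν.trim (ℱ.le n))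
  filter_upwards [hμlim, hνlim, htrim, Measure.rnDeriv_eq_div_rnDeriv_add μ ν,
    Measure.rnDeriv_pos hν, hν (Measure.rnDeriv_ne_top ν (μ + ν))] with x hμx hνx hx hdiv hpos htop
  simp only [hx, hdiv, ENNReal.toReal_div]
  exact hμx.div hνx (ENNReal.toReal_pos hpos.ne' htop).ne'

end TrimmedDensity

section InfiniteProduct

variable {ι : Type*} {X : ι → Type*}

open scoped Classical in
theorem indicator_pi_prod (s u : Finset ι) (t : ∀ i, Set (X i)) (f : ∀ i, X i → ℝ≥0∞)
    (x : ∀ i, X i) :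
    (Set.pi (u : Set ι) t).indicator (fun x => ∏ i ∈ s, f i (x i)) x =
      ∏ i ∈ s ∪ u, (u.piecewise t (fun _ => Set.univ) i).indicator
        (s.piecewise f (fun _ => 1) i) (x i) := by
  by_cases hx : x ∈ Set.pi (u : Set ι) t
  · have hmem : ∀ i, x i ∈ u.piecewise t (fun _ => Set.univ) i := fun i => by
      by_cases hi : i ∈ u
      · simpa [hi] using hx i hi
      · simp [hi]
    rw [Set.indicator_of_mem hx,
      Finset.prod_congr rfl fun i _ => Set.indicator_of_mem (hmem i) _,
      ← Finset.prod_subset (Finset.subset_union_left (s₂ := u))]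
    · exact Finset.prod_congr rfl fun i hi => by simp [hi]
    · intro i _ hi
      simp [hi]
  · obtain ⟨i, hi, hxi⟩ : ∃ i ∈ u, x i ∉ t i := by simpa [Set.mem_pi] using hx
    rw [Set.indicator_of_notMem hx]
    exact (Finset.prod_eq_zero (Finset.mem_union_right s hi) (by simp [hi, hxi])).symm

variable [∀ i, MeasurableSpace (X i)]

theorem measurable_eval_piFinset {s : Finset ι} {i : ι} (hi : i ∈ s) :
    Measurable[Filtration.piFinset (X := X) s] fun x => x i :=
  (measurable_pi_apply (⟨i, hi⟩ : s)).comp (comap_measurable s.restrict)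

theorem lintegral_prod_infinitePi (P : ∀ i, Measure (X i)) [∀ i, IsProbabilityMeasure (P i)]
    (s : Finset ι) {f : ∀ i, X i → ℝ≥0∞} (hf : ∀ i, Measurable (f i)) :
    ∫⁻ x, ∏ i ∈ s, f i (x i) ∂Measure.infinitePi P = ∏ i ∈ s, ∫⁻ a, f i a ∂P i := by
  rw [lintegral_prod_eq_prod_lintegral_of_indepFun s (fun i (x : ∀ i, X i) => f i (x i))
    (iIndepFun_infinitePi hf) fun i => (hf i).comp (measurable_pi_apply i)]
  exact Finset.prod_congr rfl fun i _ =>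
    (measurePreserving_eval_infinitePi P i).lintegral_comp (hf i)

theorem isProbabilityMeasure_piecewise (P Q : ∀ i, Measure (X i)) [∀ i, IsProbabilityMeasure (P i)]
    [∀ i, IsProbabilityMeasure (Q i)] (s : Finset ι) [DecidablePred (· ∈ s)] (i : ι) :
    IsProbabilityMeasure (s.piecewise P Q i) := by
  by_cases hi : i ∈ s <;> simp only [hi, not_false_eq_true, Finset.piecewise_eq_of_mem,
    Finset.piecewise_eq_of_notMem] <;> infer_instance

open scoped Classical in
theorem infinitePi_withDensity_prod (P : ∀ i, Measure (X i)) [∀ i, IsProbabilityMeasure (P i)]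
    {f : ∀ i, X i → ℝ≥0∞} (hf : ∀ i, Measurable (f i))
    [∀ i, IsProbabilityMeasure ((P i).withDensity (f i))] (s : Finset ι) :
    (Measure.infinitePi P).withDensity (fun x => ∏ i ∈ s, f i (x i)) =
      Measure.infinitePi (s.piecewise (fun i => (P i).withDensity (f i)) P) := by
  have : ∀ i, IsProbabilityMeasure (s.piecewise (fun i => (P i).withDensity (f i)) P i) :=
    isProbabilityMeasure_piecewise _ _ s
  refine Measure.eq_infinitePi _ fun u t ht => ?_
  have hbox : MeasurableSet (Set.pi (u : Set ι) t) :=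
    MeasurableSet.pi u.countable_toSet fun i _ => ht i
  have ht' : ∀ i, MeasurableSet (u.piecewise t (fun _ => Set.univ) i) := fun i => by
    by_cases hi : i ∈ u <;> simp [hi, ht]
  have hf' : ∀ i, Measurable (s.piecewise f (fun _ => 1) i) := fun i => by
    by_cases hi : i ∈ s <;> simp [hi, hf, measurable_one]
  have hmass : ∀ i, ∫⁻ a, (u.piecewise t (fun _ => Set.univ) i).indicator
      (s.piecewise f (fun _ => 1) i) a ∂P i =
        s.piecewise (fun i => (P i).withDensity (f i)) P i (u.piecewise t (fun _ => Set.univ) i) :=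
    fun i => by
      rw [lintegral_indicator (ht' i)]
      by_cases hi : i ∈ s <;> simp [hi, withDensity_apply _ (ht' i)]
  rw [withDensity_apply _ hbox, ← lintegral_indicator hbox,
    lintegral_congr (indicator_pi_prod s u t f),
    lintegral_prod_infinitePi P _ fun i => (hf' i).indicator (ht' i),
    Finset.prod_congr rfl fun i _ => hmass i, ← Finset.prod_subset Finset.subset_union_right]
  · exact Finset.prod_congr rfl fun i hi => by simp [hi]
  · intro i _ hi
    simp [hi]

theorem infinitePi_trim_piFinset_congr {P Q : ∀ i, Measure (X i)}
    [∀ i, IsProbabilityMeasure (P i)] [∀ i, IsProbabilityMeasure (Q i)] {s : Finset ι}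
    (h : ∀ i ∈ s, P i = Q i) :
    (Measure.infinitePi P).trim (Filtration.piFinset.le s) =
      (Measure.infinitePi Q).trim (Filtration.piFinset.le s) := by
  refine @Measure.ext _ (Filtration.piFinset s) _ _ ?_
  rintro _ ⟨t, ht, rfl⟩
  have hmap : (fun i : s => P i) = fun i : s => Q i := funext fun i => h i i.2
  have happly : ∀ (R : ∀ i, Measure (X i)) [∀ i, IsProbabilityMeasure (R i)],
      (Measure.infinitePi R).trim (Filtration.piFinset.le s) (s.restrict ⁻¹' t) =
        Measure.pi (fun i : s => R i) t := by
    intro R _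
    rw [← Measure.infinitePi_map_restrict]
    exact trim_comap_apply s.measurable_restrict ht
  rw [happly P, happly Q, hmap]

theorem infinitePi_trim_piFinset (P : ∀ i, Measure (X i)) [∀ i, IsProbabilityMeasure (P i)]
    {f : ∀ i, X i → ℝ≥0∞} (hf : ∀ i, Measurable (f i))
    [∀ i, IsProbabilityMeasure ((P i).withDensity (f i))] (s : Finset ι) :
    (Measure.infinitePi fun i => (P i).withDensity (f i)).trim (Filtration.piFinset.le s) =
      ((Measure.infinitePi P).trim (Filtration.piFinset.le s)).withDensity
        fun x => ∏ i ∈ s, f i (x i) := by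
  classical
  have : ∀ i, IsProbabilityMeasure (s.piecewise (fun i => (P i).withDensity (f i)) P i) :=
    isProbabilityMeasure_piecewise _ _ s
  have hmeas : Measurable[Filtration.piFinset s] fun x : ∀ i, X i => ∏ i ∈ s, f i (x i) :=
    Finset.measurable_fun_prod s fun i hi => (hf i).comp (measurable_eval_piFinset hi)
  rw [← trim_withDensity _ hmeas, infinitePi_withDensity_prod P hf s]
  exact infinitePi_trim_piFinset_congr fun i hi => by simp [hi]

end InfiniteProduct

section CoordinateFiltration

/-- The filtration of a product space whose `n`-th σ-algebra is generated by the first `n`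
coordinates. -/
def coordinateFiltration (X : ℕ → Type*) [∀ n, MeasurableSpace (X n)] :
    Filtration ℕ (inferInstance : MeasurableSpace (∀ n, X n)) where
  seq n := Filtration.piFinset (Finset.range n)
  mono' _ _ hmn := Filtration.piFinset.mono (Finset.range_subset_range.2 hmn)
  le' n := Filtration.piFinset.le (Finset.range n)

variable {X : ℕ → Type*} [∀ n, MeasurableSpace (X n)]

theorem iSup_coordinateFiltration :
    ⨆ n, coordinateFiltration X n = (inferInstance : MeasurableSpace (∀ n, X n)) := by
  refine le_antisymm (iSup_le (coordinateFiltration X).le) (iSup_le fun i => ?_)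
  exact (measurable_eval_piFinset (Finset.self_mem_range_succ i)).comap_le.trans
    (le_iSup (coordinateFiltration X) (i + 1))

end CoordinateFiltration

section ZeroOneLaw

theorem tendsto_prod_range_zero_iff {u : ℕ → ℝ} (hu : ∀ n, u n ≠ 0) (k : ℕ) :
    Tendsto (fun n => ∏ i ∈ Finset.range n, u i) atTop (𝓝 0) ↔
      Tendsto (fun n => ∏ i ∈ Finset.range n, u (k + i)) atTop (𝓝 0) := by
  have hne : ∏ i ∈ Finset.range k, u i ≠ 0 := Finset.prod_ne_zero_iff.2 fun i _ => hu i
  rw [← tendsto_add_atTop_iff_nat k]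
  simp only [add_comm _ k, Finset.prod_range_add]
  simpa using tendsto_const_smul_iff₀ (f := fun n => ∏ i ∈ Finset.range n, u (k + i)) (a := 0)
    (l := atTop) hne

variable {X : ℕ → Type*} [∀ n, MeasurableSpace (X n)]

theorem ae_tendsto_prod_zero_or (P : ∀ n, Measure (X n))
    [∀ n, IsProbabilityMeasure (P n)] {q : ∀ n, X n → ℝ} (hq : ∀ n, Measurable (q n))
    (hne : ∀ n a, q n a ≠ 0) :
    (∀ᵐ x ∂Measure.infinitePi P, Tendsto (fun n => ∏ i ∈ Finset.range n, q i (x i)) atTop (𝓝 0)) ∨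
    ∀ᵐ x ∂Measure.infinitePi P,
      ¬ Tendsto (fun n => ∏ i ∈ Finset.range n, q i (x i)) atTop (𝓝 0) := by
  let E : Set (∀ n, X n) :=
    {x | Tendsto (fun n => ∏ i ∈ Finset.range n, q i (x i)) atTop (𝓝 0)}
  have hle : ∀ n, MeasurableSpace.comap (fun x : ∀ n, X n => x n) inferInstance ≤
      (inferInstance : MeasurableSpace (∀ n, X n)) := fun n => (measurable_pi_apply n).comap_le
  have hindep := iIndepFun_infinitePi (P := P) (X := fun _ a => a) fun _ => measurable_id
  have htail : MeasurableSet[limsup (fun n =>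
      MeasurableSpace.comap (fun x : ∀ n, X n => x n) inferInstance) atTop] E := by
    rw [limsup_eq_iInf_iSup_of_nat, MeasurableSpace.measurableSet_iInf]
    intro k
    have hE : E = {x | Tendsto (fun n => ∏ i ∈ Finset.range n, q (k + i) (x (k + i))) atTop
        (𝓝 0)} :=
      Set.ext fun x => tendsto_prod_range_zero_iff (fun n => hne n (x n)) k
    rw [hE]
    refine measurableSet_tendsto (𝓝 0) fun n => ?_
    refine Finset.measurable_fun_prod _ fun i _ => (hq (k + i)).comp ?_
    exact measurable_iff_comap_le.2 (le_iSup₂_of_le (k + i) (Nat.le_add_right k i) le_rfl)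
  rcases measure_zero_or_one_of_measurableSet_limsup_atTop hle hindep htail with h0 | h1
  · exact Or.inr (measure_eq_zero_iff_ae_notMem.1 h0)
  · exact Or.inl ((prob_compl_eq_zero_iff (limsup_le_iSup.trans (iSup_le hle) _ htail)).2 h1)

end ZeroOneLaw

section Kakutani

/-- `q` is a strictly positive density of `Q` with respect to `P`. -/
structure IsPositiveDensity {Ω : Type*} [MeasurableSpace Ω] (P Q : Measure Ω) (q : Ω → ℝ) :
    Prop where
  measurable : Measurable q
  pos : ∀ a, 0 < q a
  eq_withDensity : Q = P.withDensity fun a => ENNReal.ofReal (q a)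

theorem IsPositiveDensity.symm {Ω : Type*} [MeasurableSpace Ω] {P Q : Measure Ω} {q : Ω → ℝ}
    (h : IsPositiveDensity P Q q) : IsPositiveDensity Q P q⁻¹ where
  measurable := h.measurable.inv
  pos a := inv_pos.2 (h.pos a)
  eq_withDensity := by
    simp only [h.eq_withDensity, Pi.inv_apply, ENNReal.ofReal_inv_of_pos (h.pos _)]
    exact (withDensity_inv_same h.measurable.ennreal_ofReal
      (ae_of_all _ fun a => (ENNReal.ofReal_pos.2 (h.pos a)).ne')
      (ae_of_all _ fun _ => ENNReal.ofReal_ne_top)).symm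

variable {X : ℕ → Type*} [∀ n, MeasurableSpace (X n)] {P Q : ∀ n, Measure (X n)}
  [∀ n, IsProbabilityMeasure (P n)] [∀ n, IsProbabilityMeasure (Q n)] {q : ∀ n, X n → ℝ}

theorem toReal_rnDeriv_trim_infinitePi (h : ∀ n, IsPositiveDensity (P n) (Q n) (q n)) (n : ℕ) :
    ∀ᵐ x ∂Measure.infinitePi P,
      (((Measure.infinitePi Q).trim ((coordinateFiltration X).le n)).rnDeriv
        ((Measure.infinitePi P).trim ((coordinateFiltration X).le n)) x).toReal =
      ∏ i ∈ Finset.range n, q i (x i) := by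
  obtain rfl : Q = fun n => (P n).withDensity fun a => ENNReal.ofReal (q n a) :=
    funext fun n => (h n).eq_withDensity
  have htrim := infinitePi_trim_piFinset P (fun n => (h n).measurable.ennreal_ofReal)
    (Finset.range n)
  have hmeas : Measurable[Filtration.piFinset (Finset.range n)] fun x : ∀ n, X n =>
      ∏ i ∈ Finset.range n, ENNReal.ofReal (q i (x i)) :=
    Finset.measurable_fun_prod _ fun i hi =>
      (h i).measurable.ennreal_ofReal.comp (measurable_eval_piFinset hi)
  filter_upwards [ae_of_ae_trim _ (Measure.rnDeriv_withDensity
    ((Measure.infinitePi P).trim ((coordinateFiltration X).le n)) hmeas)] with x hx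
  rw [← ENNReal.toReal_ofReal (Finset.prod_nonneg fun i _ => ((h i).pos (x i)).le),
    ENNReal.ofReal_prod_of_nonneg fun i _ => ((h i).pos (x i)).le, ← hx]
  exact congrArg (fun μ => (Measure.rnDeriv μ _ x).toReal) htrim

theorem tendsto_prod_rnDeriv_infinitePi (h : ∀ n, IsPositiveDensity (P n) (Q n) (q n)) :
    ∀ᵐ x ∂Measure.infinitePi P, Tendsto (fun n => ∏ i ∈ Finset.range n, q i (x i)) atTop
      (𝓝 ((Measure.infinitePi Q).rnDeriv (Measure.infinitePi P) x).toReal) := by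
  filter_upwards [tendsto_toReal_rnDeriv_trim (Measure.infinitePi Q) (Measure.infinitePi P)
    (coordinateFiltration X) iSup_coordinateFiltration,
    ae_all_iff.2 (toReal_rnDeriv_trim_infinitePi h)] with x hx hprod
  exact hx.congr hprod

theorem infinitePi_absolutelyContinuous_or_mutuallySingular
    (h : ∀ n, IsPositiveDensity (P n) (Q n) (q n)) :
    Measure.infinitePi P ≪ Measure.infinitePi Q ∨
      Measure.MutuallySingular (Measure.infinitePi Q) (Measure.infinitePi P) := by
  have hlim := tendsto_prod_rnDeriv_infinitePi h
  rcases ae_tendsto_prod_zero_or P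
    (fun n => (h n).measurable) fun n a => ((h n).pos a).ne' with hzero | hzero
  · right
    rw [← Measure.rnDeriv_eq_zero]
    filter_upwards [hlim, hzero, Measure.rnDeriv_ne_top (Measure.infinitePi Q)
      (Measure.infinitePi P)] with x hx hx0 htop
    exact (ENNReal.toReal_eq_zero_iff _).1 (tendsto_nhds_unique hx hx0) |>.resolve_right htop
  · left
    refine (withDensity_absolutelyContinuous' (Measure.measurable_rnDeriv _ _).aemeasurable
      ?_).trans (Measure.withDensity_rnDeriv_le (Measure.infinitePi Q)
        (Measure.infinitePi P)).absolutelyContinuous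
    filter_upwards [hlim, hzero] with x hx hx0 hd
    exact hx0 (by simpa [hd] using hx)

theorem infinitePi_equivalent_or_mutuallySingular
    (h : ∀ n, IsPositiveDensity (P n) (Q n) (q n)) :
    (Measure.infinitePi P ≪ Measure.infinitePi Q ∧ Measure.infinitePi Q ≪ Measure.infinitePi P) ∨
      Measure.MutuallySingular (Measure.infinitePi Q) (Measure.infinitePi P) := by
  rcases infinitePi_absolutelyContinuous_or_mutuallySingular h with hPQ | hsing
  · rcases infinitePi_absolutelyContinuous_or_mutuallySingular fun n => (h n).symm with hQP | hsing
    · exact Or.inl ⟨hPQ, hQP⟩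
    · exact Or.inr hsing.symm
  · exact Or.inr hsing

theorem not_mutuallySingular_infinitePi (h : ∀ n, IsPositiveDensity (P n) (Q n) (q n))
    {C : ℝ≥0∞} (hC : C ≠ ∞)
    (hbound : ∀ n, ∏ i ∈ Finset.range n, ∫⁻ a, ENNReal.ofReal (q i a) ∂Q i ≤ C) :
    ¬ Measure.MutuallySingular (Measure.infinitePi Q) (Measure.infinitePi P) := by
  -- singularity makes the densities of `P` vanish in the limit, so `∏ q → ∞`, contradicting Fatou
  intro hsing
  have htop : ∀ᵐ x ∂Measure.infinitePi Q,
      Tendsto (fun n => ∏ i ∈ Finset.range n, ENNReal.ofReal (q i (x i))) atTop (𝓝 ∞) := by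
    filter_upwards [tendsto_prod_rnDeriv_infinitePi fun n => (h n).symm,
      (Measure.rnDeriv_eq_zero _ _).2 hsing.symm] with x hx hzero
    rw [hzero] at hx
    have hinv := tendsto_inv_iff.2 (ENNReal.tendsto_ofReal hx)
    simp only [Pi.zero_apply, ENNReal.toReal_zero, ENNReal.ofReal_zero, ENNReal.inv_zero] at hinv
    refine hinv.congr fun n => ?_
    simp only [Pi.inv_apply, Finset.prod_inv_distrib]
    rw [ENNReal.ofReal_inv_of_pos (Finset.prod_pos fun i _ => (h i).pos _), inv_inv,
      ENNReal.ofReal_prod_of_nonneg fun i _ => ((h i).pos _).le]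
  have hfatou : ∫⁻ _, ∞ ∂Measure.infinitePi Q ≤ C := by
    calc ∫⁻ _, ∞ ∂Measure.infinitePi Q
        = ∫⁻ x, liminf (fun n => ∏ i ∈ Finset.range n, ENNReal.ofReal (q i (x i))) atTop
            ∂Measure.infinitePi Q :=
          lintegral_congr_ae (htop.mono fun x hx => hx.liminf_eq.symm)
      _ ≤ liminf (fun n => ∫⁻ x, ∏ i ∈ Finset.range n, ENNReal.ofReal (q i (x i))
            ∂Measure.infinitePi Q) atTop :=
          lintegral_liminf_le fun n => Finset.measurable_fun_prod _ fun i _ =>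
            (h i).measurable.ennreal_ofReal.comp (measurable_pi_apply i)
      _ ≤ C := by
          refine liminf_le_of_le (by isBoundedDefault) fun b hb => ?_
          obtain ⟨n, hn⟩ := hb.exists
          refine hn.trans ?_
          rw [lintegral_prod_infinitePi Q _ (f := fun i a => ENNReal.ofReal (q i a))
            fun i => (h i).measurable.ennreal_ofReal]
          exact hbound n
  exact hC (top_le_iff.1 (by simpa using hfatou))

theorem IsPositiveDensity.lintegral_le_exp {Ω : Type*} [MeasurableSpace Ω] {P Q : Measure Ω}
    [IsProbabilityMeasure P] [IsProbabilityMeasure Q] {q : Ω → ℝ} (h : IsPositiveDensity P Q q)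
    {v : ℝ} (hlog : ∀ a, Real.log (q a) ^ 2 ≤ v) :
    ∫⁻ a, ENNReal.ofReal (q a) ∂Q ≤ ENNReal.ofReal (Real.exp v) := by
  -- `q + q⁻¹ = 2 cosh (log q) ≤ 2 exp (v / 2) ≤ exp v + 1`, and `q⁻¹` has `Q`-integral `1`
  have hcosh : ∀ a, q a + (q a)⁻¹ ≤ Real.exp v + 1 := fun a => by
    have hexp : Real.cosh (Real.log (q a)) ≤ Real.exp (v / 2) :=
      (Real.cosh_le_exp_half_sq _).trans (Real.exp_le_exp.2 (by linarith [hlog a]))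
    rw [Real.cosh_log (h.pos a)] at hexp
    have hsq : Real.exp v = Real.exp (v / 2) ^ 2 := by rw [← Real.exp_nat_mul]; ring_nf
    nlinarith [sq_nonneg (Real.exp (v / 2) - 1)]
  have hinv : ∫⁻ a, ENNReal.ofReal (q a)⁻¹ ∂Q = 1 := by
    rw [← measure_univ (μ := P), h.symm.eq_withDensity, withDensity_apply _ .univ,
      Measure.restrict_univ]
    rfl
  refine ENNReal.le_of_add_le_add_right ENNReal.one_ne_top ?_
  calc ∫⁻ a, ENNReal.ofReal (q a) ∂Q + 1
      = ∫⁻ a, ENNReal.ofReal (q a + (q a)⁻¹) ∂Q := by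
        rw [← hinv, ← lintegral_add_left h.measurable.ennreal_ofReal]
        exact lintegral_congr fun a =>
          (ENNReal.ofReal_add (h.pos a).le (inv_pos.2 (h.pos a)).le).symm
    _ ≤ ∫⁻ _, ENNReal.ofReal (Real.exp v + 1) ∂Q :=
        lintegral_mono fun a => ENNReal.ofReal_le_ofReal (hcosh a)
    _ = ENNReal.ofReal (Real.exp v) + 1 := by
        simp [ENNReal.ofReal_add (Real.exp_pos v).le zero_le_one]

theorem not_mutuallySingular_infinitePi_of_summable
    (h : ∀ n, IsPositiveDensity (P n) (Q n) (q n)) {v : ℕ → ℝ} (hv : Summable v)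
    (hlog : ∀ n a, Real.log (q n a) ^ 2 ≤ v n) :
    ¬ Measure.MutuallySingular (Measure.infinitePi Q) (Measure.infinitePi P) := by
  have := fun n => nonempty_of_isProbabilityMeasure (P n)
  have hv0 : ∀ n, 0 ≤ v n := fun n => (sq_nonneg _).trans (hlog n (Classical.arbitrary _))
  refine not_mutuallySingular_infinitePi h
    (ENNReal.ofReal_ne_top (r := Real.exp (∑' n, v n))) fun n => ?_
  calc ∏ i ∈ Finset.range n, ∫⁻ a, ENNReal.ofReal (q i a) ∂Q i
      ≤ ∏ i ∈ Finset.range n, ENNReal.ofReal (Real.exp (v i)) :=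
        Finset.prod_le_prod' fun i _ => (h i).lintegral_le_exp (hlog i)
    _ = ENNReal.ofReal (Real.exp (∑ i ∈ Finset.range n, v i)) := by
        rw [Real.exp_sum, ENNReal.ofReal_prod_of_nonneg fun i _ => (Real.exp_pos _).le]
    _ ≤ ENNReal.ofReal (Real.exp (∑' n, v n)) :=
        ENNReal.ofReal_le_ofReal <| Real.exp_le_exp.2 <| hv.sum_le_tsum _ fun i _ => hv0 i

theorem infinitePi_eq_withDensity_of_summable
    (h : ∀ n, IsPositiveDensity (P n) (Q n) (q n)) {v : ℕ → ℝ} (hv : Summable v)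
    (hlog : ∀ n a, Real.log (q n a) ^ 2 ≤ v n) {H : (∀ n, X n) → ℝ}
    (hH : ∀ᵐ x ∂Measure.infinitePi P,
      Tendsto (fun n => ∏ i ∈ Finset.range n, q i (x i)) atTop (𝓝 (H x))) :
    Measure.infinitePi Q = (Measure.infinitePi P).withDensity fun x => ENNReal.ofReal (H x) := by
  have hac := (infinitePi_equivalent_or_mutuallySingular h).resolve_right
    (not_mutuallySingular_infinitePi_of_summable h hv hlog)
  rw [← Measure.withDensity_rnDeriv_eq _ _ hac.2]
  refine withDensity_congr_ae ?_
  filter_upwards [tendsto_prod_rnDeriv_infinitePi h, hH, Measure.rnDeriv_ne_top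
    (Measure.infinitePi Q) (Measure.infinitePi P)] with x hx hHx htop
  rw [tendsto_nhds_unique hHx hx, ENNReal.ofReal_toReal htop]

end Kakutani

section Shift

variable {X : Type*}

theorem shift_iterate_apply (n : ℕ) (x : Seq X) (i : ℕ) : (shift^[n] x) i = x (i + n) := by
  induction n generalizing x with
  | zero => rfl
  | succ n ih => rw [Function.iterate_succ_apply, ih, shift, add_assoc]

variable [MeasurableSpace X]

theorem measurable_shift : Measurable (shift : Seq X → Seq X) :=
  measurable_pi_iff.2 fun n => measurable_pi_apply (n + 1)

theorem indep_coordinateFiltration_comap_shift (P : ℕ → Measure X)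
    [∀ n, IsProbabilityMeasure (P n)] (n : ℕ) :
    Indep (coordinateFiltration (fun _ => X) n) (MeasurableSpace.comap shift^[n] inferInstance)
      (Measure.infinitePi P) := by
  let m : ℕ → MeasurableSpace (Seq X) := fun i =>
    MeasurableSpace.comap (fun x => x i) inferInstance
  have hindep : iIndep m (Measure.infinitePi P) := by
    rw [← iIndepFun_iff_iIndep]
    exact iIndepFun_infinitePi (X := fun _ a => a) fun _ => measurable_id
  refine indep_of_indep_of_le_left (indep_of_indep_of_le_right
    (indep_iSup_of_disjoint (fun i => (measurable_pi_apply i).comap_le) hindep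
      (Set.Iio_disjoint_Ici le_rfl : Disjoint (Set.Iio n) (Set.Ici n))) ?_) ?_
  · refine Measurable.comap_le ((@measurable_pi_iff _ _ _ (_) _ _).2 fun i => ?_)
    simp only [shift_iterate_apply]
    exact measurable_iff_comap_le.2 (le_iSup₂_of_le (i + n) (Nat.le_add_left n i) le_rfl)
  · refine Measurable.comap_le ((@measurable_pi_iff _ _ _ (_) _ _).2 fun i => ?_)
    exact measurable_iff_comap_le.2
      (le_iSup₂_of_le i.1 (Finset.mem_range.1 i.2) le_rfl)

theorem map_shift_infinitePi (P : ℕ → Measure X) [∀ n, IsProbabilityMeasure (P n)] :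
    (Measure.infinitePi P).map shift = Measure.infinitePi fun n => P (n + 1) :=
  Measure.map_infinitePi_infinitePi_of_inj (P := P) (add_left_injective 1)

/-- The sequence with first letter `a` followed by `x`. -/
def consSeq (a : X) (x : Seq X) : Seq X
  | 0 => a
  | n + 1 => x n

omit [MeasurableSpace X] in
theorem consSeq_shift (x : Seq X) : consSeq (x 0) (shift x) = x := by
  funext n
  cases n <;> rfl

theorem measurable_consSeq : Measurable fun p : X × Seq X => consSeq p.1 p.2 := by
  refine measurable_pi_iff.2 fun n => ?_
  cases n with
  | zero => exact measurable_fst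
  | succ n => exact (measurable_pi_apply n).comp measurable_snd

theorem measurePreserving_consSeq (P : ℕ → Measure X) [∀ n, IsProbabilityMeasure (P n)] :
    MeasurePreserving (fun p : X × Seq X => consSeq p.1 p.2)
      ((P 0).prod (Measure.infinitePi fun n => P (n + 1))) (Measure.infinitePi P) := by
  refine ⟨measurable_consSeq, ?_⟩
  have hindep : IndepFun (fun x : Seq X => x 0) shift (Measure.infinitePi P) :=
    indep_of_indep_of_le_left (indep_coordinateFiltration_comap_shift P 1)
      (measurable_eval_piFinset (Finset.self_mem_range_succ 0)).comap_le
  have hmap := hindep.map_prod_eq_prod_map_map (measurable_pi_apply 0).aemeasurable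
    measurable_shift.aemeasurable
  rw [Measure.infinitePi_map_eval, map_shift_infinitePi] at hmap
  rw [← hmap, Measure.map_map measurable_consSeq ((measurable_pi_apply 0).prodMk measurable_shift)]
  convert Measure.map_id using 2
  exact funext consSeq_shift

/-- The signed measure with density `f` with respect to `μ` is shift-invariant. -/
def IsShiftInvariantDensity (μ : Measure (Seq X)) (f : Seq X → ℝ) : Prop :=
  ∀ B, MeasurableSet B → ∫ x in shift ⁻¹' B, f x ∂μ = ∫ x in B, f x ∂μ

theorem IsShiftInvariantDensity.sub {μ : Measure (Seq X)} {f₁ f₂ : Seq X → ℝ}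
    (h₁ : IsShiftInvariantDensity μ f₁) (h₂ : IsShiftInvariantDensity μ f₂)
    (hf₁ : Integrable f₁ μ) (hf₂ : Integrable f₂ μ) : IsShiftInvariantDensity μ (f₁ - f₂) :=
  fun B hB => by
    rw [integral_sub' hf₁.integrableOn hf₂.integrableOn,
      integral_sub' hf₁.integrableOn hf₂.integrableOn, h₁ B hB, h₂ B hB]

theorem IsShiftInvariantDensity.setIntegral_preimage_iterate {μ : Measure (Seq X)}
    {f : Seq X → ℝ} (h : IsShiftInvariantDensity μ f) (n : ℕ) {B : Set (Seq X)}
    (hB : MeasurableSet B) : ∫ x in shift^[n] ⁻¹' B, f x ∂μ = ∫ x in B, f x ∂μ := by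
  induction n generalizing B with
  | zero => rfl
  | succ n ih =>
    rw [Function.iterate_succ', Set.preimage_comp, ih (measurable_shift hB), h B hB]

theorem setIntegral_condExp_preimage_shift_iterate (P : ℕ → Measure X)
    [∀ n, IsProbabilityMeasure (P n)] (f : Seq X → ℝ) (n : ℕ) {B : Set (Seq X)}
    (hB : MeasurableSet B) :
    ∫ x in shift^[n] ⁻¹' B,
        ((Measure.infinitePi P)[f | coordinateFiltration (fun _ => X) n]) x ∂Measure.infinitePi P =
      (Measure.infinitePi P).real (shift^[n] ⁻¹' B) * ∫ x, f x ∂Measure.infinitePi P := by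
  have hle := (measurable_shift.iterate n).comap_le (α := Seq X)
  rw [← setIntegral_condExp hle integrable_condExp ⟨B, hB, rfl⟩,
    integral_congr_ae (ae_restrict_of_ae (condExp_indep_eq
      ((coordinateFiltration fun _ => X).le n) hle stronglyMeasurable_condExp
      (indep_coordinateFiltration_comap_shift P n))),
    setIntegral_const, smul_eq_mul, integral_condExp ((coordinateFiltration fun _ => X).le n)]

theorem IsShiftInvariantDensity.enorm_setIntegral_le {P : ℕ → Measure X}
    [∀ n, IsProbabilityMeasure (P n)] {f : Seq X → ℝ}
    (h : IsShiftInvariantDensity (Measure.infinitePi P) f)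
    (hf : Integrable f (Measure.infinitePi P))
    (hzero : ∫ x, f x ∂Measure.infinitePi P = 0) {B : Set (Seq X)} (hB : MeasurableSet B) (n : ℕ) :
    ‖∫ x in B, f x ∂Measure.infinitePi P‖ₑ ≤
      eLpNorm ((Measure.infinitePi P)[f | coordinateFiltration (fun _ => X) n] - f) 1
        (Measure.infinitePi P) := by
  have hcond := setIntegral_condExp_preimage_shift_iterate P f n hB
  rw [hzero, mul_zero] at hcond
  rw [← h.setIntegral_preimage_iterate n hB, ← enorm_neg, ← zero_sub, ← hcond,
    ← integral_sub' integrable_condExp.integrableOn hf.integrableOn,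
    eLpNorm_one_eq_lintegral_enorm]
  exact (enorm_integral_le_lintegral_enorm _).trans (setLIntegral_le_lintegral _ _)

theorem IsShiftInvariantDensity.ae_eq_zero {P : ℕ → Measure X}
    [∀ n, IsProbabilityMeasure (P n)] {f : Seq X → ℝ}
    (h : IsShiftInvariantDensity (Measure.infinitePi P) f)
    (hf : Integrable f (Measure.infinitePi P))
    (hzero : ∫ x, f x ∂Measure.infinitePi P = 0) : f =ᵐ[Measure.infinitePi P] 0 := by
  have hself : (Measure.infinitePi P)[f | ⨆ n, coordinateFiltration (fun _ => X) n]
      =ᵐ[Measure.infinitePi P] f := by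
    rw [iSup_coordinateFiltration]
    exact condExp_of_aestronglyMeasurable' le_rfl hf.1 hf
  have hlim := (tendsto_eLpNorm_condExp (μ := Measure.infinitePi P)
    (ℱ := coordinateFiltration fun _ => X) f).congr fun n =>
      eLpNorm_congr_ae ((EventuallyEq.refl _ _).sub hself)
  refine hf.ae_eq_of_forall_setIntegral_eq _ _ (integrable_zero _ _ _) fun B hB _ => ?_
  rw [enorm_eq_zero.1 (le_zero_iff.1 (ge_of_tendsto' hlim (h.enorm_setIntegral_le hf hzero hB)))]
  simp

end Shift

section Weights

variable {A : Type*} {g : ℕ → A → ℝ}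

/-- The sup norm of `log g_{n+1}` as a real number; it takes the junk value `0` when the norm is
infinite, which does not happen for an `ℓ₁`-bounded potential. -/
noncomputable def logNorm (g : ℕ → A → ℝ) (n : ℕ) : ℝ :=
  (⨆ a, ‖Real.log (g (n + 1) a)‖ₑ).toReal

theorem logNorm_nonneg (g : ℕ → A → ℝ) (n : ℕ) : 0 ≤ logNorm g n := ENNReal.toReal_nonneg

theorem L1Bounded.summable_logNorm (hbdd : L1Bounded g) : Summable (logNorm g) :=
  ENNReal.summable_toReal hbdd.ne

theorem L1Bounded.summable_logNorm_sq (hbdd : L1Bounded g) :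
    Summable fun n => logNorm g n ^ 2 := by
  refine (hbdd.summable_logNorm.mul_left (∑' k, logNorm g k)).of_nonneg_of_le
    (fun n => sq_nonneg _) fun n => ?_
  rw [sq]
  exact mul_le_mul_of_nonneg_right
    (hbdd.summable_logNorm.le_tsum n fun k _ => logNorm_nonneg g k) (logNorm_nonneg g n)

theorem L1Bounded.abs_log_le (hbdd : L1Bounded g) (n : ℕ) (a : A) :
    |Real.log (g (n + 1) a)| ≤ logNorm g n := by
  rw [← Real.norm_eq_abs, ← toReal_enorm]
  exact ENNReal.toReal_mono (ENNReal.ne_top_of_tsum_ne_top hbdd.ne n)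
    (le_iSup (fun a => ‖Real.log (g (n + 1) a)‖ₑ) a)

theorem L1Bounded.drop (hbdd : L1Bounded g) (k : ℕ) : L1Bounded fun n => g (n + k) := by
  refine lt_of_eq_of_lt (tsum_congr fun n => ?_) ((ENNReal.tsum_comp_le_tsum_of_injective
    (add_left_injective k) fun n => ⨆ a, ‖Real.log (g (n + 1) a)‖ₑ).trans_lt hbdd)
  rw [add_right_comm]

theorem L1Bounded.summable_log (hbdd : L1Bounded g) (x : Seq A) :
    Summable fun n => Real.log (g n (x n)) :=
  (summable_nat_add_iff 1).1 <| hbdd.summable_logNorm.of_norm_bounded fun _ => hbdd.abs_log_le _ _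

theorem L1Bounded.multipliable (hbdd : L1Bounded g) (hpos : ∀ n a, 0 < g n a) (x : Seq A) :
    Multipliable fun n => g n (x n) :=
  Real.multipliable_of_summable_log (fun _ => hpos _ _) (hbdd.summable_log x)

theorem L1Bounded.exp_tsum_log (hbdd : L1Bounded g) (hpos : ∀ n a, 0 < g n a) (x : Seq A) :
    Real.exp (∑' n, Real.log (g n (x n))) = potential g x :=
  Real.rexp_tsum_eq_tprod (fun _ => hpos _ _) (hbdd.summable_log x)

theorem L1Bounded.potential_pos (hbdd : L1Bounded g) (hpos : ∀ n a, 0 < g n a) (x : Seq A) :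
    0 < potential g x :=
  hbdd.exp_tsum_log hpos x ▸ Real.exp_pos _

theorem L1Bounded.tendsto_prod_potential (hbdd : L1Bounded g) (hpos : ∀ n a, 0 < g n a)
    (x : Seq A) :
    Tendsto (fun n => ∏ i ∈ Finset.range n, g i (x i)) atTop (𝓝 (potential g x)) :=
  (hbdd.multipliable hpos x).hasProd.tendsto_prod_nat

theorem L1Bounded.potential_eq_prod_mul (hbdd : L1Bounded g) (hpos : ∀ n a, 0 < g n a) (k : ℕ)
    (x : Seq A) :
    potential g x = (∏ i ∈ Finset.range k, g i (x i)) *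
      potential (fun n => g (n + k)) fun n => x (n + k) :=
  (Multipliable.prod_mul_tprod_nat_mul' (f := fun n => g n (x n))
    ((hbdd.drop k).multipliable (fun n => hpos (n + k)) fun n => x (n + k))).symm

theorem L1Bounded.measurable_potential [MeasurableSpace A] (hbdd : L1Bounded g)
    (hpos : ∀ n a, 0 < g n a) (hg : ∀ n, Measurable (g n)) : Measurable (potential g) :=
  measurable_of_tendsto_metrizable
    (fun _ => Finset.measurable_fun_prod _ fun i _ => (hg i).comp (measurable_pi_apply i))
    (tendsto_pi_nhds.2 (hbdd.tendsto_prod_potential hpos))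

theorem partialWeight_pos (hpos : ∀ n a, 0 < g n a) (n : ℕ) (a : A) : 0 < partialWeight g n a :=
  Finset.prod_pos fun _ _ => hpos _ _

theorem partialWeight_zero (g : ℕ → A → ℝ) : partialWeight g 0 = g 0 :=
  funext fun a => Finset.prod_range_one fun i => g i a

theorem partialWeight_succ (g : ℕ → A → ℝ) (n : ℕ) (a : A) :
    partialWeight g (n + 1) a = partialWeight g n a * g (n + 1) a :=
  Finset.prod_range_succ _ _

theorem L1Bounded.fullWeight_pos (hbdd : L1Bounded g) (hpos : ∀ n a, 0 < g n a) (a : A) :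
    0 < fullWeight g a :=
  hbdd.potential_pos hpos fun _ => a

theorem L1Bounded.fullWeight_eq_mul (hbdd : L1Bounded g) (hpos : ∀ n a, 0 < g n a) (n : ℕ)
    (a : A) : fullWeight g a = partialWeight g n a * ∏' l, g (l + 1 + n) a := by
  simp only [add_right_comm _ 1 n]
  exact hbdd.potential_eq_prod_mul hpos (n + 1) fun _ => a

theorem L1Bounded.tendsto_partialWeight (hbdd : L1Bounded g) (hpos : ∀ n a, 0 < g n a) (a : A) :
    Tendsto (fun n => partialWeight g n a) atTop (𝓝 (fullWeight g a)) :=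
  (hbdd.tendsto_prod_potential hpos fun _ => a).comp (tendsto_add_atTop_nat 1)

theorem L1Bounded.partialWeight_le (hbdd : L1Bounded g) (hpos : ∀ n a, 0 < g n a) (n : ℕ)
    (a : A) : partialWeight g n a ≤ g 0 a * Real.exp (∑' k, logNorm g k) := by
  rw [partialWeight, Finset.prod_range_succ', mul_comm]
  refine mul_le_mul_of_nonneg_left ?_ (hpos 0 a).le
  calc ∏ k ∈ Finset.range n, g (k + 1) a
      ≤ ∏ k ∈ Finset.range n, Real.exp (logNorm g k) :=
        Finset.prod_le_prod (fun k _ => (hpos _ a).le) fun k _ =>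
          (Real.log_le_iff_le_exp (hpos _ a)).1 ((le_abs_self _).trans (hbdd.abs_log_le k a))
    _ = Real.exp (∑ k ∈ Finset.range n, logNorm g k) := (Real.exp_sum _ _).symm
    _ ≤ Real.exp (∑' k, logNorm g k) :=
        Real.exp_le_exp.2 (hbdd.summable_logNorm.sum_le_tsum _ fun k _ => logNorm_nonneg g k)

theorem summable_partialWeight (hpos : ∀ n a, 0 < g n a) (hbdd : L1Bounded g)
    (hsum : SummablePotential g) (n : ℕ) : Summable (partialWeight g n) :=
  (hsum.mul_right _).of_nonneg_of_le (fun a => (partialWeight_pos hpos n a).le)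
    (hbdd.partialWeight_le hpos n)

theorem summable_fullWeight (hpos : ∀ n a, 0 < g n a) (hbdd : L1Bounded g)
    (hsum : SummablePotential g) : Summable (fullWeight g) :=
  (hsum.mul_right _).of_nonneg_of_le (fun a => (hbdd.fullWeight_pos hpos a).le) fun a =>
    le_of_tendsto' (hbdd.tendsto_partialWeight hpos a) fun n => hbdd.partialWeight_le hpos n a

theorem tsum_pos_of_pos [Nonempty A] {w : A → ℝ} (hw : ∀ a, 0 < w a) (hws : Summable w) :
    0 < ∑' a, w a :=
  hws.tsum_pos (fun a => (hw a).le) (Classical.arbitrary A) (hw _)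

theorem tsum_partialWeight_pos [Nonempty A] (hpos : ∀ n a, 0 < g n a) (hbdd : L1Bounded g)
    (hsum : SummablePotential g) (n : ℕ) : 0 < ∑' a, partialWeight g n a :=
  tsum_pos_of_pos (partialWeight_pos hpos n) (summable_partialWeight hpos hbdd hsum n)

theorem eigenvalue_pos [Nonempty A] (hpos : ∀ n a, 0 < g n a) (hbdd : L1Bounded g)
    (hsum : SummablePotential g) : 0 < eigenvalue g :=
  tsum_pos_of_pos (hbdd.fullWeight_pos hpos) (summable_fullWeight hpos hbdd hsum)

theorem tendsto_tsum_partialWeight (hpos : ∀ n a, 0 < g n a) (hbdd : L1Bounded g)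
    (hsum : SummablePotential g) :
    Tendsto (fun n => ∑' a, partialWeight g n a) atTop (𝓝 (eigenvalue g)) := by
  refine tendsto_tsum_of_dominated_convergence
    (hsum.mul_right (Real.exp (∑' k, logNorm g k)))
    (hbdd.tendsto_partialWeight hpos) (Eventually.of_forall fun n a => ?_)
  rw [Real.norm_of_nonneg (partialWeight_pos hpos n a).le]
  exact hbdd.partialWeight_le hpos n a

end Weights

section NormalizedMeasure

variable {A : Type*} {w w' : A → ℝ}

/-- The density of `normalizedMeasure w'` with respect to `normalizedMeasure w`. -/
noncomputable def normalizedDensity (w w' : A → ℝ) (a : A) : ℝ :=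
  (∑' b, w b) / (∑' b, w' b) * (w' a / w a)

theorem abs_log_div_le_iff {x y t : ℝ} (hx : 0 < x) (hy : 0 < y) :
    |Real.log (x / y)| ≤ t ↔ x ≤ Real.exp t * y ∧ y ≤ Real.exp t * x := by
  rw [abs_le', ← Real.log_inv, inv_div, Real.log_le_iff_le_exp (div_pos hx hy),
    Real.log_le_iff_le_exp (div_pos hy hx), div_le_iff₀ hy, div_le_iff₀ hx]

theorem abs_log_normalizedDensity_le [Nonempty A] (hw : ∀ a, 0 < w a) (hw' : ∀ a, 0 < w' a)
    (hws : Summable w) (hws' : Summable w') {t : ℝ} (ht : ∀ a, |Real.log (w' a / w a)| ≤ t)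
    (a : A) : |Real.log (normalizedDensity w w' a)| ≤ 2 * t := by
  have hZ := tsum_pos_of_pos hw hws
  have hZ' := tsum_pos_of_pos hw' hws'
  have hsum : |Real.log ((∑' b, w b) / ∑' b, w' b)| ≤ t := by
    simp only [abs_log_div_le_iff (hw' _) (hw _)] at ht
    rw [abs_log_div_le_iff hZ hZ', ← tsum_mul_left, ← tsum_mul_left]
    exact ⟨hws.tsum_le_tsum (fun b => (ht b).2) (hws'.mul_left _),
      hws'.tsum_le_tsum (fun b => (ht b).1) (hws.mul_left _)⟩
  rw [normalizedDensity, Real.log_mul (div_pos hZ hZ').ne' (div_pos (hw' a) (hw a)).ne', two_mul]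
  exact (abs_add_le _ _).trans (add_le_add hsum (ht a))

variable [MeasurableSpace A]

theorem isProbabilityMeasure_normalizedMeasure [Nonempty A] (hw : ∀ a, 0 < w a)
    (hws : Summable w) : IsProbabilityMeasure (normalizedMeasure w) := by
  have hZ := tsum_pos_of_pos hw hws
  constructor
  rw [normalizedMeasure, Measure.sum_apply _ .univ]
  simp only [Measure.smul_apply, measure_univ, smul_eq_mul, mul_one]
  rw [← ENNReal.ofReal_tsum_of_nonneg (fun a => (div_pos (hw a) hZ).le) (hws.div_const _),
    tsum_div_const, div_self hZ.ne', ENNReal.ofReal_one]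

variable [MeasurableSingletonClass A]

theorem normalizedMeasure_singleton (w : A → ℝ) (a : A) :
    normalizedMeasure w {a} = ENNReal.ofReal (w a / ∑' b, w b) := by
  rw [normalizedMeasure, Measure.sum_apply _ (measurableSet_singleton a), tsum_eq_single a]
  · simp
  · intro b hb
    simp [hb]

theorem hasSum_integral_normalizedMeasure [Countable A] (hw : ∀ a, 0 ≤ w a) {f : A → ℝ}
    (hf : Integrable f (normalizedMeasure w)) :
    HasSum (fun a => w a / (∑' b, w b) * f a) (∫ a, f a ∂normalizedMeasure w) := by
  have h := hasSum_integral_sum_dirac (fun _ => ENNReal.ofReal_ne_top) hf.summable_of_dirac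
  simpa only [ENNReal.toReal_ofReal (div_nonneg (hw _) (tsum_nonneg hw))] using! h

theorem isPositiveDensity_normalizedDensity [Nonempty A] [Countable A] (hw : ∀ a, 0 < w a)
    (hw' : ∀ a, 0 < w' a) (hws : Summable w) (hws' : Summable w') :
    IsPositiveDensity (normalizedMeasure w) (normalizedMeasure w') (normalizedDensity w w') := by
  have hZ := tsum_pos_of_pos hw hws
  have hZ' := tsum_pos_of_pos hw' hws'
  refine ⟨measurable_of_countable _, fun a => mul_pos (div_pos hZ hZ') (div_pos (hw' a) (hw a)),
    Measure.ext_of_singleton fun a => ?_⟩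
  rw [withDensity_apply _ (measurableSet_singleton a), lintegral_singleton,
    normalizedMeasure_singleton, normalizedMeasure_singleton,
    ← ENNReal.ofReal_mul' (div_pos (hw a) hZ).le, normalizedDensity]
  have := (hw a).ne'
  congr 1
  field_simp

end NormalizedMeasure

section Densities

variable {A : Type*} {g : ℕ → A → ℝ}

theorem hFactor_eq_normalizedDensity (hpos : ∀ n a, 0 < g n a) (hbdd : L1Bounded g) (n : ℕ) :
    hFactor g n = normalizedDensity (partialWeight g n) (fullWeight g) := by
  funext a
  rw [hFactor, normalizedDensity, hbdd.fullWeight_eq_mul hpos n a,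
    mul_div_cancel_left₀ _ (partialWeight_pos hpos n a).ne']

theorem L1Bounded.iSup_enorm_tsum_log_sq_ne_top (hbdd : L1Bounded g) (k : ℕ) :
    ⨆ a, ‖∑' j, Real.log (g (k + 1 + j) a)‖ₑ ^ 2 ≠ ∞ := by
  refine ((iSup_le fun a => ?_).trans_lt (ENNReal.pow_lt_top (n := 2) hbdd)).ne
  gcongr
  calc ‖∑' j, Real.log (g (k + 1 + j) a)‖ₑ
      ≤ ∑' j, ‖Real.log (g (k + j + 1) a)‖ₑ := by
        simpa only [add_right_comm k 1] using enorm_tsum_le_tsum_enorm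
    _ ≤ ∑' j, ⨆ a, ‖Real.log (g (k + j + 1) a)‖ₑ :=
        ENNReal.tsum_le_tsum fun j => le_iSup (fun a => ‖Real.log (g (k + j + 1) a)‖ₑ) a
    _ ≤ ∑' n, ⨆ a, ‖Real.log (g (n + 1) a)‖ₑ :=
        ENNReal.tsum_comp_le_tsum_of_injective (add_right_injective k) fun n =>
          ⨆ a, ‖Real.log (g (n + 1) a)‖ₑ

theorem L2BoundedTails.summable_toReal (h2 : L2BoundedTails g) :
    Summable fun n => (⨆ a, ‖∑' j, Real.log (g (n + 1 + j) a)‖ₑ ^ 2).toReal := by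
  obtain ⟨k, hk⟩ := h2
  rw [← summable_nat_add_iff k]
  refine ((summable_nat_add_iff 1).2 (ENNReal.summable_toReal hk.ne)).congr fun n => ?_
  rw [show k + (n + 1) = n + k + 1 by ring]

theorem abs_log_fullWeight_div_partialWeight_le (hpos : ∀ n a, 0 < g n a) (hbdd : L1Bounded g)
    (n : ℕ) (a : A) : |Real.log (fullWeight g a / partialWeight g n a)| ≤
      √(⨆ b, ‖∑' j, Real.log (g (n + 1 + j) b)‖ₑ ^ 2).toReal := by
  have hlog : Real.log (fullWeight g a / partialWeight g n a) =
      ∑' j, Real.log (g (n + 1 + j) a) := by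
    rw [← Real.log_exp (∑' j, Real.log (g (n + 1 + j) a))]
    simp only [add_comm (n + 1)]
    rw [(hbdd.drop (n + 1)).exp_tsum_log (fun j => hpos (j + (n + 1))) fun _ => a]
    refine congrArg Real.log ((div_eq_iff (partialWeight_pos hpos n a).ne').2 ?_)
    exact (hbdd.potential_eq_prod_mul hpos (n + 1) fun _ => a).trans (mul_comm _ _)
  rw [hlog]
  refine Real.le_sqrt_of_sq_le ?_
  rw [← Real.norm_eq_abs, ← toReal_enorm, ← ENNReal.toReal_pow]
  exact ENNReal.toReal_mono (hbdd.iSup_enorm_tsum_log_sq_ne_top n)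
    (le_iSup (fun b => ‖∑' j, Real.log (g (n + 1 + j) b)‖ₑ ^ 2) a)

theorem log_hFactor_sq_le [Nonempty A] (hpos : ∀ n a, 0 < g n a) (hbdd : L1Bounded g)
    (hsum : SummablePotential g) (n : ℕ) (a : A) : Real.log (hFactor g n a) ^ 2 ≤
      4 * (⨆ b, ‖∑' j, Real.log (g (n + 1 + j) b)‖ₑ ^ 2).toReal := by
  have hlog := abs_log_normalizedDensity_le (partialWeight_pos hpos n) (hbdd.fullWeight_pos hpos)
    (summable_partialWeight hpos hbdd hsum n) (summable_fullWeight hpos hbdd hsum)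
    (abs_log_fullWeight_div_partialWeight_le hpos hbdd n) a
  rw [← hFactor_eq_normalizedDensity hpos hbdd] at hlog
  refine (sq_le_sq' (abs_le.1 hlog).1 (abs_le.1 hlog).2).trans_eq ?_
  rw [mul_pow, Real.sq_sqrt ENNReal.toReal_nonneg]
  norm_num

theorem prod_normalizedDensity_partialWeight [Nonempty A] (hpos : ∀ n a, 0 < g n a)
    (hbdd : L1Bounded g) (hsum : SummablePotential g) (n : ℕ) (x : Seq A) :
    ∏ i ∈ Finset.range n, normalizedDensity (partialWeight g i) (partialWeight g (i + 1)) (x i) =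
      (∑' a, partialWeight g 0 a) / (∑' a, partialWeight g n a) *
        ∏ i ∈ Finset.range n, g (i + 1) (x i) := by
  have hZ := fun n => (tsum_partialWeight_pos hpos hbdd hsum n).ne'
  induction n with
  | zero => simp [hZ 0]
  | succ n ih =>
    rw [Finset.prod_range_succ, Finset.prod_range_succ, ih, normalizedDensity,
      partialWeight_succ g n (x n), mul_div_cancel_left₀ _ (partialWeight_pos hpos n _).ne']
    have := hZ n
    have := hZ (n + 1)
    field_simp

/-- The density of `(conformalMeasure g).map shift` with respect to `conformalMeasure g`. -/
noncomputable def shiftDensity (g : ℕ → A → ℝ) (x : Seq A) : ℝ :=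
  (∑' a, partialWeight g 0 a) / eigenvalue g * potential (fun n => g (n + 1)) x

theorem shiftDensity_pos [Nonempty A] (hpos : ∀ n a, 0 < g n a) (hbdd : L1Bounded g)
    (hsum : SummablePotential g) (x : Seq A) : 0 < shiftDensity g x :=
  mul_pos (div_pos (tsum_partialWeight_pos hpos hbdd hsum 0) (eigenvalue_pos hpos hbdd hsum))
    ((hbdd.drop 1).potential_pos (fun n => hpos (n + 1)) x)

theorem measurable_shiftDensity [Countable A] [MeasurableSpace A] [MeasurableSingletonClass A]
    (hpos : ∀ n a, 0 < g n a) (hbdd : L1Bounded g) : Measurable (shiftDensity g) :=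
  ((hbdd.drop 1).measurable_potential (fun n => hpos (n + 1))
    fun n => measurable_of_countable (g (n + 1))).const_mul _

variable [Nonempty A] [MeasurableSpace A]

variable (hpos : ∀ n a, 0 < g n a) (hbdd : L1Bounded g) (hsum : SummablePotential g)

include hpos hbdd hsum

theorem isProbabilityMeasure_partialWeight (n : ℕ) :
    IsProbabilityMeasure (normalizedMeasure (partialWeight g n)) :=
  isProbabilityMeasure_normalizedMeasure (partialWeight_pos hpos n)
    (summable_partialWeight hpos hbdd hsum n)

theorem isProbabilityMeasure_fullWeight : IsProbabilityMeasure (normalizedMeasure (fullWeight g)) :=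
  isProbabilityMeasure_normalizedMeasure (hbdd.fullWeight_pos hpos)
    (summable_fullWeight hpos hbdd hsum)

theorem isProbabilityMeasure_conformalMeasure : IsProbabilityMeasure (conformalMeasure g) := by
  have := isProbabilityMeasure_partialWeight hpos hbdd hsum
  exact inferInstanceAs (IsProbabilityMeasure (Measure.infinitePi _))

theorem isProbabilityMeasure_equilibriumMeasure : IsProbabilityMeasure (equilibriumMeasure g) := by
  have := isProbabilityMeasure_fullWeight hpos hbdd hsum
  exact inferInstanceAs (IsProbabilityMeasure (Measure.infinitePi _))

variable [Countable A] [MeasurableSingletonClass A]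

theorem isPositiveDensity_hFactor (n : ℕ) :
    IsPositiveDensity (normalizedMeasure (partialWeight g n)) (normalizedMeasure (fullWeight g))
      (hFactor g n) := by
  rw [hFactor_eq_normalizedDensity hpos hbdd]
  exact isPositiveDensity_normalizedDensity (partialWeight_pos hpos n) (hbdd.fullWeight_pos hpos)
    (summable_partialWeight hpos hbdd hsum n) (summable_fullWeight hpos hbdd hsum)

theorem map_shift_conformalMeasure :
    (conformalMeasure g).map shift =
      (conformalMeasure g).withDensity fun x => ENNReal.ofReal (shiftDensity g x) := by
  have hw := partialWeight_pos hpos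
  have hws := summable_partialWeight hpos hbdd hsum
  have := isProbabilityMeasure_partialWeight hpos hbdd hsum
  rw [conformalMeasure, map_shift_infinitePi]
  have hstep : ∀ n a, |Real.log (partialWeight g (n + 1) a / partialWeight g n a)| ≤
      logNorm g n := fun n a => by
    rw [partialWeight_succ, mul_div_cancel_left₀ _ (hw n a).ne']
    exact hbdd.abs_log_le n a
  refine infinitePi_eq_withDensity_of_summable
    (fun n => isPositiveDensity_normalizedDensity (hw n) (hw (n + 1)) (hws n) (hws (n + 1)))
    (hbdd.summable_logNorm_sq.mul_left (2 ^ 2)) (fun n a => ?_) (ae_of_all _ fun x => ?_)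
  · have hlog := abs_le.1 (abs_log_normalizedDensity_le (hw n) (hw (n + 1)) (hws n) (hws (n + 1))
      (hstep n) a)
    exact (sq_le_sq' hlog.1 hlog.2).trans_eq (mul_pow _ _ _)
  · simp only [prod_normalizedDensity_partialWeight hpos hbdd hsum]
    exact (tendsto_const_nhds.div (tendsto_tsum_partialWeight hpos hbdd hsum)
      (eigenvalue_pos hpos hbdd hsum).ne').mul
      ((hbdd.drop 1).tendsto_prod_potential (fun n => hpos (n + 1)) x)

end Densities

section Ruelle

variable {A : Type*} {g : ℕ → A → ℝ}

/-- The preimages of `x` under the shift are indexed by the alphabet. -/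
def shiftFiberEquiv (x : Seq A) : A ≃ {y : Seq A // shift y = x} where
  toFun a := ⟨consSeq a x, rfl⟩
  invFun y := y.1 0
  left_inv _ := rfl
  right_inv := by
    rintro ⟨y, rfl⟩
    exact Subtype.ext (consSeq_shift y)

theorem potential_consSeq (hpos : ∀ n a, 0 < g n a) (hbdd : L1Bounded g) (a : A) (x : Seq A) :
    potential g (consSeq a x) = g 0 a * potential (fun n => g (n + 1)) x := by
  rw [hbdd.potential_eq_prod_mul hpos 1, Finset.prod_range_one]
  rfl

theorem ruelle_indicator_shift_preimage (φ f : Seq A → ℝ) (B : Set (Seq A)) :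
    ruelle φ ((shift ⁻¹' B).indicator f) = B.indicator (ruelle φ f) := by
  funext x
  have hfib : ∀ y : {y : Seq A // shift y = x}, y.1 ∈ shift ⁻¹' B ↔ x ∈ B := fun y => by
    rw [Set.mem_preimage, y.2]
  by_cases hx : x ∈ B <;> simp [ruelle, Set.indicator, hfib, hx]

variable [Nonempty A] [Countable A] [MeasurableSpace A] [MeasurableSingletonClass A]

variable (hpos : ∀ n a, 0 < g n a) (hbdd : L1Bounded g) (hsum : SummablePotential g)

include hpos hbdd hsum

theorem hasSum_ruelle {f : Seq A → ℝ} {x : Seq A}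
    (hf : Integrable (fun a => f (consSeq a x)) (normalizedMeasure (partialWeight g 0))) :
    HasSum (fun y : {y : Seq A // shift y = x} => f y * Real.exp (Real.log (potential g y)))
      (eigenvalue g * (shiftDensity g x *
        ∫ a, f (consSeq a x) ∂normalizedMeasure (partialWeight g 0))) := by
  rw [← (shiftFiberEquiv x).hasSum_iff, ← mul_assoc]
  refine ((hasSum_integral_normalizedMeasure (fun a => (partialWeight_pos hpos 0 a).le)
    hf).mul_left _).congr_fun fun a => ?_
  have := (tsum_partialWeight_pos hpos hbdd hsum 0).ne'
  have := (eigenvalue_pos hpos hbdd hsum).ne'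
  change f (consSeq a x) * Real.exp (Real.log (potential g (consSeq a x))) = _
  rw [Real.exp_log (hbdd.potential_pos hpos _), potential_consSeq hpos hbdd, shiftDensity,
    ← partialWeight_zero g]
  field_simp

theorem measurePreserving_consSeq_conformalMeasure :
    MeasurePreserving (fun p : A × Seq A => consSeq p.1 p.2)
      ((normalizedMeasure (partialWeight g 0)).prod
        ((conformalMeasure g).withDensity fun x => ENNReal.ofReal (shiftDensity g x)))
      (conformalMeasure g) := by
  have := isProbabilityMeasure_partialWeight hpos hbdd hsum
  rw [← map_shift_conformalMeasure hpos hbdd hsum, conformalMeasure, map_shift_infinitePi]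
  exact measurePreserving_consSeq fun n => normalizedMeasure (partialWeight g n)

variable {f : Seq A → ℝ}

theorem ae_integrable_consSeq (hf : Integrable f (conformalMeasure g)) :
    ∀ᵐ x ∂conformalMeasure g,
      Integrable (fun a => f (consSeq a x)) (normalizedMeasure (partialWeight g 0)) := by
  have := isProbabilityMeasure_partialWeight hpos hbdd hsum 0
  have := isProbabilityMeasure_conformalMeasure hpos hbdd hsum
  have hac := withDensity_absolutelyContinuous' (μ := conformalMeasure g)
    (measurable_shiftDensity hpos hbdd).ennreal_ofReal.aemeasurable
    (ae_of_all _ fun x => (ENNReal.ofReal_pos.2 (shiftDensity_pos hpos hbdd hsum x)).ne')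
  exact hac.ae_le ((measurePreserving_consSeq_conformalMeasure hpos hbdd
    hsum).integrable_comp_of_integrable hf).swap.prod_right_ae

theorem ae_ruelleConverges (hf : Integrable f (conformalMeasure g)) :
    ∀ᵐ x ∂conformalMeasure g, RuelleConverges (fun x => Real.log (potential g x)) f x :=
  (ae_integrable_consSeq hpos hbdd hsum hf).mono fun _ hx =>
    (hasSum_ruelle hpos hbdd hsum hx).summable

theorem ruelle_ae_eq (hf : Integrable f (conformalMeasure g)) :
    ruelle (fun x => Real.log (potential g x)) f =ᵐ[conformalMeasure g] fun x =>
      eigenvalue g * (shiftDensity g x *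
        ∫ a, f (consSeq a x) ∂normalizedMeasure (partialWeight g 0)) :=
  (ae_integrable_consSeq hpos hbdd hsum hf).mono fun _ hx =>
    (hasSum_ruelle hpos hbdd hsum hx).tsum_eq

theorem integrable_ruelle (hf : Integrable f (conformalMeasure g)) :
    Integrable (ruelle (fun x => Real.log (potential g x)) f) (conformalMeasure g) := by
  have := isProbabilityMeasure_partialWeight hpos hbdd hsum 0
  have := isProbabilityMeasure_conformalMeasure hpos hbdd hsum
  have hfc := ((measurePreserving_consSeq_conformalMeasure hpos hbdd
    hsum).integrable_comp_of_integrable hf).integral_prod_right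
  rw [integrable_withDensity_iff_integrable_smul'
    (measurable_shiftDensity hpos hbdd).ennreal_ofReal
    (ae_of_all _ fun _ => ENNReal.ofReal_lt_top)] at hfc
  simp only [ENNReal.toReal_ofReal (shiftDensity_pos hpos hbdd hsum _).le, smul_eq_mul] at hfc
  exact (hfc.const_mul (eigenvalue g)).congr (ruelle_ae_eq hpos hbdd hsum hf).symm

/-- Conformality of `μ = conformalMeasure g`, that is `𝓛* μ = λ μ`. -/
theorem integral_ruelle (hf : Integrable f (conformalMeasure g)) :
    ∫ x, ruelle (fun x => Real.log (potential g x)) f x ∂conformalMeasure g =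
      eigenvalue g * ∫ x, f x ∂conformalMeasure g := by
  have := isProbabilityMeasure_partialWeight hpos hbdd hsum 0
  have := isProbabilityMeasure_conformalMeasure hpos hbdd hsum
  have hcons := measurePreserving_consSeq_conformalMeasure hpos hbdd hsum
  rw [integral_congr_ae (ruelle_ae_eq hpos hbdd hsum hf), integral_const_mul]
  refine congrArg (eigenvalue g * ·) (Eq.symm ?_)
  calc ∫ x, f x ∂conformalMeasure g
      = ∫ p : A × Seq A, f (consSeq p.1 p.2) ∂_ := by
        conv_lhs => rw [← hcons.map_eq]
        exact integral_map hcons.aemeasurable (hcons.map_eq.symm ▸ hf.1)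
    _ = ∫ x, ∫ a, f (consSeq a x) ∂normalizedMeasure (partialWeight g 0)
          ∂(conformalMeasure g).withDensity fun x => ENNReal.ofReal (shiftDensity g x) :=
        integral_prod_symm _ (hcons.integrable_comp_of_integrable hf)
    _ = ∫ x, shiftDensity g x * ∫ a, f (consSeq a x) ∂normalizedMeasure (partialWeight g 0)
          ∂conformalMeasure g := by
        rw [integral_withDensity_eq_integral_toReal_smul
          (measurable_shiftDensity hpos hbdd).ennreal_ofReal
          (ae_of_all _ fun _ => ENNReal.ofReal_lt_top)]
        simp only [ENNReal.toReal_ofReal (shiftDensity_pos hpos hbdd hsum _).le, smul_eq_mul]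

theorem setIntegral_ruelle (hf : Integrable f (conformalMeasure g)) {B : Set (Seq A)}
    (hB : MeasurableSet B) :
    ∫ x in B, ruelle (fun x => Real.log (potential g x)) f x ∂conformalMeasure g =
      eigenvalue g * ∫ x in shift ⁻¹' B, f x ∂conformalMeasure g := by
  rw [← integral_indicator hB, ← integral_indicator (measurable_shift hB),
    ← ruelle_indicator_shift_preimage,
    integral_ruelle hpos hbdd hsum (hf.indicator (measurable_shift hB))]

theorem ruelle_ae_eq_eigenvalue_mul_iff (hf : Integrable f (conformalMeasure g)) :
    (ruelle (fun x => Real.log (potential g x)) f =ᵐ[conformalMeasure g]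
      fun x => eigenvalue g * f x) ↔ IsShiftInvariantDensity (conformalMeasure g) f := by
  refine ⟨fun h B hB => ?_, fun h => (integrable_ruelle hpos hbdd hsum
    hf).ae_eq_of_forall_setIntegral_eq _ _ (hf.const_mul _) fun B hB _ => ?_⟩
  · have hset := setIntegral_ruelle hpos hbdd hsum hf hB
    rw [integral_congr_ae (ae_restrict_of_ae h), integral_const_mul] at hset
    exact (mul_left_cancel₀ (eigenvalue_pos hpos hbdd hsum).ne' hset).symm
  · rw [setIntegral_ruelle hpos hbdd hsum hf hB, h B hB, integral_const_mul]

theorem ae_eq_of_ruelle_ae_eq {h₁ h₂ : Seq A → ℝ} (hi₁ : Integrable h₁ (conformalMeasure g))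
    (hi₂ : Integrable h₂ (conformalMeasure g))
    (he₁ : ruelle (fun x => Real.log (potential g x)) h₁
      =ᵐ[conformalMeasure g] fun x => eigenvalue g * h₁ x)
    (he₂ : ruelle (fun x => Real.log (potential g x)) h₂
      =ᵐ[conformalMeasure g] fun x => eigenvalue g * h₂ x)
    (h : ∫ x, h₁ x ∂conformalMeasure g = ∫ x, h₂ x ∂conformalMeasure g) :
    h₁ =ᵐ[conformalMeasure g] h₂ := by
  have := isProbabilityMeasure_partialWeight hpos hbdd hsum
  have hinv₁ := (ruelle_ae_eq_eigenvalue_mul_iff hpos hbdd hsum hi₁).1 he₁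
  have hinv₂ := (ruelle_ae_eq_eigenvalue_mul_iff hpos hbdd hsum hi₂).1 he₂
  have hzero := (hinv₁.sub hinv₂ hi₁ hi₂).ae_eq_zero (hi₁.sub hi₂)
    ((integral_sub' hi₁ hi₂).trans (sub_eq_zero.2 h))
  exact hzero.mono fun x hx => sub_eq_zero.1 hx

end Ruelle

section LimitDensity

variable {A : Type*} [Nonempty A] [Countable A] [MeasurableSpace A] [MeasurableSingletonClass A]
  {g : ℕ → A → ℝ}

variable (hpos : ∀ n a, 0 < g n a) (hbdd : L1Bounded g) (hsum : SummablePotential g)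

include hpos hbdd hsum

theorem ae_tendsto_hPartial_rnDeriv :
    ∀ᵐ x ∂conformalMeasure g, Tendsto (fun n => hPartial g n x) atTop
      (𝓝 ((equilibriumMeasure g).rnDeriv (conformalMeasure g) x).toReal) :=
  have := isProbabilityMeasure_partialWeight hpos hbdd hsum
  have := isProbabilityMeasure_fullWeight hpos hbdd hsum
  tendsto_prod_rnDeriv_infinitePi (isPositiveDensity_hFactor hpos hbdd hsum)

theorem ae_tendsto_hPartial :
    ∀ᵐ x ∂conformalMeasure g, Tendsto (fun n => hPartial g n x) atTop (𝓝 (hMu g x)) :=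
  (ae_tendsto_hPartial_rnDeriv hpos hbdd hsum).mono fun _ hx => tendsto_nhds_limUnder ⟨_, hx⟩

theorem hMu_ae_eq_rnDeriv :
    hMu g =ᵐ[conformalMeasure g]
      fun x => ((equilibriumMeasure g).rnDeriv (conformalMeasure g) x).toReal :=
  (ae_tendsto_hPartial_rnDeriv hpos hbdd hsum).mono fun _ hx => hx.limUnder_eq

theorem integrable_hMu : Integrable (hMu g) (conformalMeasure g) := by
  have := isProbabilityMeasure_equilibriumMeasure hpos hbdd hsum
  exact Measure.integrable_toReal_rnDeriv.congr (hMu_ae_eq_rnDeriv hpos hbdd hsum).symm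

theorem setIntegral_hMu (hac : equilibriumMeasure g ≪ conformalMeasure g) (B : Set (Seq A)) :
    ∫ x in B, hMu g x ∂conformalMeasure g = (equilibriumMeasure g).real B := by
  have := isProbabilityMeasure_conformalMeasure hpos hbdd hsum
  have := isProbabilityMeasure_equilibriumMeasure hpos hbdd hsum
  rw [integral_congr_ae (ae_restrict_of_ae (hMu_ae_eq_rnDeriv hpos hbdd hsum)),
    Measure.setIntegral_toReal_rnDeriv hac]

theorem integral_hMu (hac : equilibriumMeasure g ≪ conformalMeasure g) :
    ∫ x, hMu g x ∂conformalMeasure g = 1 := by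
  have := isProbabilityMeasure_equilibriumMeasure hpos hbdd hsum
  rw [← setIntegral_univ, setIntegral_hMu hpos hbdd hsum hac, probReal_univ]

theorem isShiftInvariantDensity_hMu (hac : equilibriumMeasure g ≪ conformalMeasure g) :
    IsShiftInvariantDensity (conformalMeasure g) (hMu g) := fun B hB => by
  have := isProbabilityMeasure_fullWeight hpos hbdd hsum
  have hinv : (equilibriumMeasure g).map shift = equilibriumMeasure g :=
    map_shift_infinitePi fun _ => normalizedMeasure (fullWeight g)
  rw [setIntegral_hMu hpos hbdd hsum hac, setIntegral_hMu hpos hbdd hsum hac,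
    ← map_measureReal_apply measurable_shift hB, hinv]

theorem equilibriumMeasure_eq_withDensity (h2 : L2BoundedTails g) :
    equilibriumMeasure g =
      (conformalMeasure g).withDensity fun x => ENNReal.ofReal (hMu g x) :=
  have := isProbabilityMeasure_partialWeight hpos hbdd hsum
  have := isProbabilityMeasure_fullWeight hpos hbdd hsum
  infinitePi_eq_withDensity_of_summable (isPositiveDensity_hFactor hpos hbdd hsum)
    (h2.summable_toReal.mul_left 4) (log_hFactor_sq_le hpos hbdd hsum)
    (ae_tendsto_hPartial hpos hbdd hsum)

theorem equivalent_or_mutuallySingular :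
    (conformalMeasure g ≪ equilibriumMeasure g ∧ equilibriumMeasure g ≪ conformalMeasure g) ∨
      Measure.MutuallySingular (equilibriumMeasure g) (conformalMeasure g) :=
  have := isProbabilityMeasure_partialWeight hpos hbdd hsum
  have := isProbabilityMeasure_fullWeight hpos hbdd hsum
  infinitePi_equivalent_or_mutuallySingular (isPositiveDensity_hFactor hpos hbdd hsum)

theorem integral_hMu_eq_zero
    (hsing : Measure.MutuallySingular (equilibriumMeasure g) (conformalMeasure g)) :
    ∫ x, hMu g x ∂conformalMeasure g = 0 := by
  have := isProbabilityMeasure_equilibriumMeasure hpos hbdd hsum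
  have := isProbabilityMeasure_conformalMeasure hpos hbdd hsum
  refine integral_eq_zero_of_ae ?_
  filter_upwards [hMu_ae_eq_rnDeriv hpos hbdd hsum, hsing.rnDeriv_ae_eq_zero] with x hx hzero
  rw [hx, hzero]
  exact ENNReal.toReal_zero

theorem integral_hMu_pos_iff :
    0 < ∫ x, hMu g x ∂conformalMeasure g ↔
      conformalMeasure g ≪ equilibriumMeasure g ∧
        equilibriumMeasure g ≪ conformalMeasure g := by
  refine ⟨fun h => ?_, fun h => integral_hMu hpos hbdd hsum h.2 ▸ one_pos⟩
  exact (equivalent_or_mutuallySingular hpos hbdd hsum).resolve_right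
    fun hsing => h.ne' (integral_hMu_eq_zero hpos hbdd hsum hsing)

end LimitDensity

end ProductPotential

open ProductPotential in
theorem theorem4p3 {A : Type*} [Nonempty A] [Countable A] [MeasurableSpace A]
    [MeasurableSingletonClass A] (g : ℕ → A → ℝ) (hpos : ∀ n a, 0 < g n a)
    (hbdd : L1Bounded g) (hsum : SummablePotential g) :
    -- uniqueness of the normalized eigenfunction in `L¹(μ)`
    (∀ h₁ h₂ : Seq A → ℝ,
      Integrable h₁ (conformalMeasure g) → Integrable h₂ (conformalMeasure g) →
      (ruelle (fun x => Real.log (potential g x)) h₁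
        =ᵐ[conformalMeasure g] fun x => eigenvalue g * h₁ x) →
      (ruelle (fun x => Real.log (potential g x)) h₂
        =ᵐ[conformalMeasure g] fun x => eigenvalue g * h₂ x) →
      ∫ x, h₁ x ∂(conformalMeasure g) = 1 → ∫ x, h₂ x ∂(conformalMeasure g) = 1 →
      h₁ =ᵐ[conformalMeasure g] h₂) ∧
    -- the explicit eigenfunction under `ℓ₂`-bounded tails
    (L2BoundedTails g →
      Integrable (hMu g) (conformalMeasure g) ∧
      ∫ x, hMu g x ∂(conformalMeasure g) = 1 ∧
      (∀ᵐ x ∂(conformalMeasure g),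
        RuelleConverges (fun x => Real.log (potential g x)) (hMu g) x) ∧
      (ruelle (fun x => Real.log (potential g x)) (hMu g)
        =ᵐ[conformalMeasure g] fun x => eigenvalue g * hMu g x) ∧
      equilibriumMeasure g =
        (conformalMeasure g).withDensity fun x => ENNReal.ofReal (hMu g x)) ∧
    -- almost sure existence of `h_μ` and the dichotomy
    ((∀ᵐ x ∂(conformalMeasure g),
        Tendsto (fun n => hPartial g n x) atTop (𝓝 (hMu g x))) ∧
      Integrable (hMu g) (conformalMeasure g) ∧
      (0 < ∫ x, hMu g x ∂(conformalMeasure g) ↔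
        conformalMeasure g ≪ equilibriumMeasure g ∧
        equilibriumMeasure g ≪ conformalMeasure g) ∧
      (∫ x, hMu g x ∂(conformalMeasure g) = 0 →
        Measure.MutuallySingular (equilibriumMeasure g) (conformalMeasure g))) := by
  have hint := integrable_hMu hpos hbdd hsum
  refine ⟨fun h₁ h₂ hi₁ hi₂ he₁ he₂ ho₁ ho₂ => ae_eq_of_ruelle_ae_eq hpos hbdd hsum hi₁ hi₂ he₁ he₂
    (ho₁.trans ho₂.symm), fun h2 => ?_, ae_tendsto_hPartial hpos hbdd hsum, hint,
    integral_hMu_pos_iff hpos hbdd hsum, fun hzero => ?_⟩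
  · have hdens := equilibriumMeasure_eq_withDensity hpos hbdd hsum h2
    have hac : equilibriumMeasure g ≪ conformalMeasure g :=
      hdens ▸ withDensity_absolutelyContinuous _ _
    exact ⟨hint, integral_hMu hpos hbdd hsum hac, ae_ruelleConverges hpos hbdd hsum hint,
      (ruelle_ae_eq_eigenvalue_mul_iff hpos hbdd hsum hint).2
        (isShiftInvariantDensity_hMu hpos hbdd hsum hac), hdens⟩
  · exact (equivalent_or_mutuallySingular hpos hbdd hsum).resolve_left fun hequiv =>
      one_ne_zero ((integral_hMu hpos hbdd hsum hequiv.2).symm.trans hzero)
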